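/- Let $n\ge 1$ and let $\Phi:\mathbb{R}\to\mathbb{R}$ be a real analytic function that is bounded below and satisfies $\lim_{y\to+\infty}\Phi(y)=+\infty$; put $\phi=\Phi'$. On $\mathbb{R}^{2n}$ with coordinates $x=(q_1,\dots,q_n,p_1,\dots,p_n)$ consider the single-forced multiparticle system $\dot x=f(x)+g\,u$, $u\in\mathbb{R}$, where $$g=\frac{\partial}{\partial p_1},\qquad f=\sum_{k=1}^{n}p_k\frac{\partial}{\partial q_k}+\sum_{k=1}^{n}F_k(q)\frac{\partial}{\partial p_k},\qquad F_k(q)=\phi(q_{k-1}-q_k)-\phi(q_k-q_{k+1}),$$ with the convention that the first term of $F_k$ is absent for $k=1$ and the second term is absent for $k=n$. Let $\mathrm{Lie}\{f,g\}$ be the real Lie algebra of analytic vector fields on $\mathbb{R}^{2n}$ generated by $f$ and $g$ with respect to the bracket $[V,W]=DW\,V-DV\,W$, let the zero-time ideal $\mathcal{I}^0$ be the Lie ideal of $\mathrm{Lie}\{f,g\}$ generated by $g$, and for $x\in\mathbb{R}^{2n}$ let $\mathcal{I}^0_x=\{V(x): V\in\mathcal{I}^0\}$ be its evaluation at $x$,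 a linear subspace of $\mathbb{R}^{2n}$. Then $\dim\mathcal{I}^0_x=2n$, that is, $\mathcal{I}^0_x=\mathbb{R}^{2n}$, at each point $x\in\mathbb{R}^{2n}$. -/

import Mathlib

noncomputable section

/-! ### The Lie algebra of real analytic vector fields -/

/-- Real analytic vector fields on a real normed space `E`: globally defined analytic maps
`E → E`, as a real vector space under pointwise operations. -/
def analyticVectorFields (E : Type*) [NormedAddCommGroup E] [NormedSpace ℝ E] :
    Submodule ℝ (E → E) where
  carrier := {F | AnalyticOnNhd ℝ F Set.univ}
  add_mem' hF hG := hF.add hG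
  zero_mem' := analyticOnNhd_const
  smul_mem' _ _ hF := analyticOnNhd_const.smul hF

/-- The type of real analytic vector fields on `E`. -/
abbrev AnalyticVectorField (E : Type*) [NormedAddCommGroup E] [NormedSpace ℝ E] : Type _ :=
  ↥(analyticVectorFields E)

namespace AnalyticVectorField

variable {E : Type*} [NormedAddCommGroup E] [NormedSpace ℝ E]

lemma differentiableAt (F : AnalyticVectorField E) (x : E) : DifferentiableAt ℝ F.1 x :=
  (F.2 x (Set.mem_univ x)).differentiableAt

variable [CompleteSpace E]

lemma contDiffAt (F : AnalyticVectorField E) (x : E) :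
    ContDiffAt ℝ (minSmoothness ℝ 2) F.1 x := by
  simpa using (F.2 x (Set.mem_univ x)).contDiffAt

lemma analyticOnNhd_fderiv_apply (F G : AnalyticVectorField E) :
    AnalyticOnNhd ℝ (fun x => fderiv ℝ F.1 x (G.1 x)) Set.univ := fun x _ =>
  ((ContinuousLinearMap.id ℝ (E →L[ℝ] E)).analyticAt_bilinear _).comp₂
    (F.2 x (Set.mem_univ x)).fderiv (G.2 x (Set.mem_univ x))

/-- The Lie bracket `[F, G](x) = DG(x) F(x) - DF(x) G(x)`. -/
instance : Bracket (AnalyticVectorField E) (AnalyticVectorField E) where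
  bracket F G := ⟨VectorField.lieBracket ℝ F.1 G.1,
    (analyticOnNhd_fderiv_apply G F).sub (analyticOnNhd_fderiv_apply F G)⟩

lemma coe_bracket (F G : AnalyticVectorField E) :
    (⁅F, G⁆ : AnalyticVectorField E).1 = VectorField.lieBracket ℝ F.1 G.1 := rfl

instance : LieRing (AnalyticVectorField E) where
  add_lie F G H := by
    ext x
    exact VectorField.lieBracket_add_left (F.differentiableAt x) (G.differentiableAt x)
  lie_add F G H := by
    ext x
    exact VectorField.lieBracket_add_right (G.differentiableAt x) (H.differentiableAt x)
  lie_self F := by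
    ext x
    simp [coe_bracket]
  leibniz_lie F G H := by
    ext x
    exact VectorField.leibniz_identity_lieBracket le_rfl
      (F.contDiffAt x) (G.contDiffAt x) (H.contDiffAt x)

instance : LieAlgebra ℝ (AnalyticVectorField E) where
  lie_smul c F G := by
    ext x
    exact VectorField.lieBracket_const_smul_right (G.differentiableAt x)

end AnalyticVectorField

/-! ### Lie envelope and zero-time ideal of `ẋ = f(x) + ∑ i, g i (x) * u i` -/

section ControlAffine

variable {E : Type*} [NormedAddCommGroup E] [NormedSpace ℝ E] [CompleteSpace E] {ι : Type*}

/-- The Lie envelope `Lie{f, g}`: the real Lie algebra of vector fields generated by the drift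
`f` and all controlled vector fields `g i`. -/
def lieEnvelope (f : AnalyticVectorField E) (g : ι → AnalyticVectorField E) :
    LieSubalgebra ℝ (AnalyticVectorField E) :=
  LieSubalgebra.lieSpan ℝ (AnalyticVectorField E) (insert f (Set.range g))

/-- The zero-time ideal: the Lie ideal of the Lie envelope generated by the controlled vector
fields `g i`. -/
def zeroTimeIdeal (f : AnalyticVectorField E) (g : ι → AnalyticVectorField E) :
    LieIdeal ℝ (lieEnvelope f g) :=
  LieSubmodule.lieSpan ℝ (lieEnvelope f g) {V | (V : AnalyticVectorField E) ∈ Set.range g}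

/-- The evaluation at `x` of the zero-time ideal: the set of all `V x`, where `V` runs through the
zero-time ideal. It is a linear subspace of `E`. -/
def zeroTimeIdealAt (f : AnalyticVectorField E) (g : ι → AnalyticVectorField E) (x : E) :
    Submodule ℝ E where
  carrier := {v | ∃ V ∈ zeroTimeIdeal f g, (V : AnalyticVectorField E).1 x = v}
  add_mem' := by
    rintro _ _ ⟨V, hV, rfl⟩ ⟨W, hW, rfl⟩
    exact ⟨V + W, add_mem hV hW, rfl⟩
  zero_mem' := ⟨0, zero_mem _, rfl⟩
  smul_mem' := by
    rintro c _ ⟨V, hV, rfl⟩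
    exact ⟨c • V, (zeroTimeIdeal f g).smul_mem c hV, rfl⟩

end ControlAffine

/-! ### The multiparticle system on a line -/

/-- The state space `ℝ^{2n}`; a state is `x = (q, p)`, positions and momenta of `n` particles,
which are indexed from `0` to `n - 1`. -/
abbrev PhaseSpace (n : ℕ) : Type := (Fin n → ℝ) × (Fin n → ℝ)

/-- The total force on the `k`-th particle, `φ (q (k-1) - q k) - φ (q k - q (k+1))`, where the
first term is absent for the first particle and the second one for the last particle. -/
def interactionForce {n : ℕ} (φ : ℝ → ℝ) (q : Fin n → ℝ) (k : Fin n) : ℝ :=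
  (if h : 0 < k.val then φ (q ⟨k.val - 1, by omega⟩ - q k) else 0) -
    (if h : k.val + 1 < n then φ (q k - q ⟨k.val + 1, h⟩) else 0)

/-- The drift of the multiparticle system with interaction potential `Φ`: the Hamiltonian vector
field `q̇ k = p k`, `ṗ k = φ (q (k-1) - q k) - φ (q k - q (k+1))`, where `φ = Φ'`. -/
def multiparticleDrift (n : ℕ) (Φ : ℝ → ℝ) (hΦ : AnalyticOnNhd ℝ Φ Set.univ) :
    AnalyticVectorField (PhaseSpace n) :=
  ⟨fun x => (x.2, interactionForce (deriv Φ) x.1), by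
    have hφ : AnalyticOnNhd ℝ (deriv Φ) Set.univ := hΦ.deriv
    have hq : ∀ i : Fin n, AnalyticOnNhd ℝ (fun x : PhaseSpace n => x.1 i) Set.univ := fun i =>
      ((ContinuousLinearMap.proj (R := ℝ) (φ := fun _ : Fin n => ℝ) i).comp
        (ContinuousLinearMap.fst ℝ (Fin n → ℝ) (Fin n → ℝ))).analyticOnNhd _
    have hd : ∀ i j : Fin n,
        AnalyticOnNhd ℝ (fun x : PhaseSpace n => deriv Φ (x.1 i - x.1 j)) Set.univ := fun i j =>
      hφ.comp ((hq i).sub (hq j)) (Set.mapsTo_univ _ _)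
    refine AnalyticOnNhd.prod (analyticOnNhd_snd) ?_
    refine AnalyticOnNhd.pi fun k => ?_
    unfold interactionForce
    refine AnalyticOnNhd.sub ?_ ?_
    · split_ifs
      · exact hd _ _
      · exact analyticOnNhd_const
    · split_ifs
      · exact hd _ _
      · exact analyticOnNhd_const⟩

/-- The constant vector field `∂/∂p_k`. -/
def momentumField {n : ℕ} (k : Fin n) : AnalyticVectorField (PhaseSpace n) :=
  ⟨fun _ => (0, Pi.single k 1), analyticOnNhd_const⟩

end

/-!
The idea is to allow analytic functions as coefficients. Near a point `x`, let `M` be the module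
over the germs of analytic functions that the zero-time ideal generates (`ZeroTimeGerm`). By the
product rule, `M` is stable under the bracket with every field of the Lie envelope and under its own
bracket (`ZeroTimeGerm.lieBracket_envelope`, `ZeroTimeGerm.lieBracket`), and passing from the ideal
to `M` does not change the evaluation at `x` (`ZeroTimeGerm.apply_mem`). The gain is that elements
of `M` may be divided by functions that do not vanish at `x`.

The fields `∂/∂p_k` and `∂/∂q_k` then all lie in `M`, by induction on `k`. Since
`[f, ∂/∂p_k] = -∂/∂q_k`, it suffices to pass from `∂/∂q_k` to `∂/∂p_{k+1}`. The field
`[f, ∂/∂q_k]` is a combination of the `∂/∂p_l` with `l ≤ k + 1` whose coefficient at `∂/∂p_{k+1}`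
is `-φ'(q_k - q_{k+1})`; hence `φ'(q_k - q_{k+1}) ∂/∂p_{k+1}` lies in `M`. Brackets with `∂/∂q_k`
replace `φ'` by its successive derivatives, and at every point one of these is nonzero, because
otherwise the analytic function `φ` would be constant and `Φ` affine, which is impossible for a
function that is bounded below and tends to `+∞` at `+∞`. Dividing by that derivative gives
`∂/∂p_{k+1}`.
-/

open Filter Topology VectorField

noncomputable section

/-! ### The module generated by the zero-time ideal over germs of analytic functions -/

lemma AnalyticAt.fderiv_apply {E F : Type*} [NormedAddCommGroup E] [NormedSpace ℝ E]
    [NormedAddCommGroup F] [NormedSpace ℝ F] [CompleteSpace F] {c : E → F} {V : E → E} {x : E}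
    (hc : AnalyticAt ℝ c x) (hV : AnalyticAt ℝ V x) :
    AnalyticAt ℝ (fun y => fderiv ℝ c y (V y)) x :=
  ((ContinuousLinearMap.id ℝ (E →L[ℝ] F)).analyticAt_bilinear _).comp₂ hc.fderiv hV

section Germ

variable {E : Type*} [NormedAddCommGroup E] [NormedSpace ℝ E] [CompleteSpace E] {ι : Type*}

/-- `ZeroTimeGerm f g x W` says that near `x` the vector field `W` is a combination, with
coefficients analytic at `x`, of elements of the zero-time ideal of `f` and `g`. Only the germ of
`W` at `x` matters, so `W` is an arbitrary map `E → E`. -/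
inductive ZeroTimeGerm (f : AnalyticVectorField E) (g : ι → AnalyticVectorField E) (x : E) :
    (E → E) → Prop
  | of (V : lieEnvelope f g) (hV : V ∈ zeroTimeIdeal f g) : ZeroTimeGerm f g x V.1.1
  | add {V W : E → E} (hV : ZeroTimeGerm f g x V) (hW : ZeroTimeGerm f g x W) :
      ZeroTimeGerm f g x (V + W)
  | smul {c : E → ℝ} (hc : AnalyticAt ℝ c x) {V : E → E} (hV : ZeroTimeGerm f g x V) :
      ZeroTimeGerm f g x (fun y => c y • V y)
  | congr {V W : E → E} (hV : ZeroTimeGerm f g x V) (h : V =ᶠ[𝓝 x] W) : ZeroTimeGerm f g x W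

namespace ZeroTimeGerm

variable {f : AnalyticVectorField E} {g : ι → AnalyticVectorField E} {x : E} {V W : E → E}

lemma analyticAt (hV : ZeroTimeGerm f g x V) : AnalyticAt ℝ V x := by
  induction hV with
  | of V _ => exact V.1.2 x (Set.mem_univ x)
  | add _ _ hV hW => exact hV.add hW
  | smul hc _ hV => exact hc.smul hV
  | congr _ h hV => exact hV.congr h

lemma eventually_differentiableAt (hV : ZeroTimeGerm f g x V) :
    ∀ᶠ y in 𝓝 x, DifferentiableAt ℝ V y :=
  hV.analyticAt.eventually_analyticAt.mono fun _ h => h.differentiableAt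

lemma apply_mem (hV : ZeroTimeGerm f g x V) : V x ∈ zeroTimeIdealAt f g x := by
  induction hV with
  | of V hV => exact ⟨V, hV, rfl⟩
  | add _ _ hV hW => exact add_mem hV hW
  | smul _ _ hV => exact Submodule.smul_mem _ _ hV
  | congr _ h hV => exact h.eq_of_nhds ▸ hV

lemma zero : ZeroTimeGerm f g x 0 := .of 0 (zero_mem _)

lemma neg (hV : ZeroTimeGerm f g x V) : ZeroTimeGerm f g x (-V) :=
  (smul (c := fun _ => -1) analyticAt_const hV).congr (.of_eq (by ext y; simp))

lemma sum {κ : Type*} (s : Finset κ) {V : κ → E → E} (hV : ∀ k ∈ s, ZeroTimeGerm f g x (V k)) :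
    ZeroTimeGerm f g x (∑ k ∈ s, V k) :=
  Finset.sum_induction _ _ (fun _ _ => add) zero hV

lemma lieBracket_envelope (U : lieEnvelope f g) (hW : ZeroTimeGerm f g x W) :
    ZeroTimeGerm f g x (lieBracket ℝ U.1.1 W) := by
  induction hW with
  | of W hW => exact of ⁅U, W⁆ ((zeroTimeIdeal f g).lie_mem hW)
  | add hV hW ihV ihW =>
    refine (ihV.add ihW).congr ?_
    filter_upwards [hV.eventually_differentiableAt, hW.eventually_differentiableAt] with y h₁ h₂
    exact (lieBracket_add_right h₁ h₂).symm
  | @smul c hc V hV ih =>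
    have hc' : AnalyticAt ℝ (fun y => fderiv ℝ c y (U.1.1 y)) x :=
      hc.fderiv_apply (U.1.2 x (Set.mem_univ x))
    refine ((smul hc' hV).add (smul hc ih)).congr ?_
    filter_upwards [hV.eventually_differentiableAt, hc.eventually_analyticAt] with y h₁ h₂
    exact (lieBracket_smul_right h₂.differentiableAt h₁).symm
  | congr _ h ih => exact ih.congr (EventuallyEq.rfl.lieBracket_vectorField h)

lemma lieBracket (hV : ZeroTimeGerm f g x V) (hW : ZeroTimeGerm f g x W) :
    ZeroTimeGerm f g x (lieBracket ℝ V W) := by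
  induction hV with
  | of V _ => exact lieBracket_envelope V hW
  | add hV hV' ih ih' =>
    refine (ih.add ih').congr ?_
    filter_upwards [hV.eventually_differentiableAt, hV'.eventually_differentiableAt] with y h₁ h₂
    exact (lieBracket_add_left h₁ h₂).symm
  | @smul c hc V hV ih =>
    have hc' : AnalyticAt ℝ (fun y => -fderiv ℝ c y (W y)) x :=
      (hc.fderiv_apply hW.analyticAt).neg
    refine ((smul hc' hV).add (smul hc ih)).congr ?_
    filter_upwards [hV.eventually_differentiableAt, hc.eventually_analyticAt] with y h₁ h₂
    rw [lieBracket_smul_left h₂.differentiableAt h₁]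
    rfl
  | congr _ h ih => exact ih.congr (h.lieBracket_vectorField EventuallyEq.rfl)

lemma of_smul {c : E → ℝ} (hc : AnalyticAt ℝ c x) (hcx : c x ≠ 0)
    (hV : ZeroTimeGerm f g x (fun y => c y • V y)) : ZeroTimeGerm f g x V := by
  refine (smul (hc.inv hcx) hV).congr ?_
  filter_upwards [hc.continuousAt.eventually_ne hcx] with y hy
  simp [smul_smul, inv_mul_cancel₀ hy]

lemma controlled (i : ι) : ZeroTimeGerm f g x (g i).1 :=
  of ⟨g i, LieSubalgebra.subset_lieSpan (Set.mem_insert_of_mem _ ⟨i, rfl⟩)⟩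
    (LieSubmodule.subset_lieSpan ⟨i, rfl⟩)

lemma lieBracket_drift (hW : ZeroTimeGerm f g x W) :
    ZeroTimeGerm f g x (VectorField.lieBracket ℝ f.1 W) :=
  lieBracket_envelope ⟨f, LieSubalgebra.subset_lieSpan (Set.mem_insert f _)⟩ hW

end ZeroTimeGerm

end Germ

/-! ### The derivatives of the interaction potential -/

lemma analyticOnNhd_iteratedDeriv {φ : ℝ → ℝ} (hφ : AnalyticOnNhd ℝ φ Set.univ) (m : ℕ) :
    AnalyticOnNhd ℝ (iteratedDeriv m φ) Set.univ := by
  rw [iteratedDeriv_eq_iterate]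
  exact hφ.iterated_deriv m

/-- If all derivatives of `deriv Φ` of positive order vanished at `y`, then `deriv Φ` would be
constant near `y`, hence everywhere, and `Φ` would be affine. -/
lemma exists_iteratedDeriv_deriv_ne_zero {Φ : ℝ → ℝ} (hΦ : AnalyticOnNhd ℝ Φ Set.univ)
    (hbdd : BddBelow (Set.range Φ)) (hlim : Tendsto Φ atTop atTop) (y : ℝ) :
    ∃ m : ℕ, iteratedDeriv (m + 1) (deriv Φ) y ≠ 0 := by
  by_contra! h
  have hd2 : AnalyticOnNhd ℝ (deriv (deriv Φ)) Set.univ := hΦ.deriv.deriv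
  have htop : analyticOrderAt (deriv (deriv Φ)) y = ⊤ := by
    refine ENat.eq_top_iff_forall_ge.2 fun m => ?_
    rw [natCast_le_analyticOrderAt_iff_iteratedDeriv_eq_zero (hd2 y (Set.mem_univ y))]
    intro i _
    rw [← iteratedDeriv_succ']
    exact h i
  have hzero : ∀ z, deriv (deriv Φ) z = 0 := fun z =>
    hd2.eqOn_zero_of_preconnected_of_eventuallyEq_zero isPreconnected_univ (Set.mem_univ y)
      (analyticOrderAt_eq_top.1 htop) (Set.mem_univ z)
  have hconst : ∀ z, deriv Φ z = deriv Φ 0 := fun z =>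
    is_const_of_deriv_eq_zero (fun w => (hΦ.deriv w (Set.mem_univ w)).differentiableAt) hzero z 0
  have haff : ∀ z, Φ z = Φ 0 + deriv Φ 0 * z := by
    have hder : ∀ z, HasDerivAt (fun w => Φ w - deriv Φ 0 * w) 0 z := fun z => by
      have h₁ := (hΦ z (Set.mem_univ z)).differentiableAt.hasDerivAt
      have h₂ : HasDerivAt (fun w => deriv Φ 0 * w) (deriv Φ 0) z := by
        simpa using (hasDerivAt_id z).const_mul (deriv Φ 0)
      have h₃ := h₁.fun_sub h₂
      rwa [hconst z, sub_self] at h₃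
    intro z
    have := is_const_of_deriv_eq_zero (fun w => (hder w).differentiableAt)
      (fun w => (hder w).deriv) z 0
    simp only [mul_zero, sub_zero] at this
    linarith
  obtain ⟨b, hb⟩ := hbdd
  have hb' : ∀ z, b ≤ Φ z := fun z => hb ⟨z, rfl⟩
  obtain ⟨z, hz⟩ := (hlim.eventually_gt_atTop (2 * Φ 0 - b)).exists
  -- An affine function satisfies `Φ z + Φ (-z) = 2 * Φ 0`.
  have h₁ := hb' (-z)
  rw [haff (-z)] at h₁
  rw [haff z] at hz
  linarith

/-! ### The fields `∂/∂q_k` and `∂/∂p_k` -/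

section Multiparticle

variable {n : ℕ} {Φ : ℝ → ℝ} (hΦ : AnalyticOnNhd ℝ Φ Set.univ)

lemma lieBracket_const_right {E : Type*} [NormedAddCommGroup E] [NormedSpace ℝ E] (V : E → E)
    (w y : E) : lieBracket ℝ V (fun _ => w) y = -fderiv ℝ V y w := by
  simp [lieBracket]

lemma hasDerivAt_multiparticleDrift (y v : PhaseSpace n) :
    HasDerivAt (fun t : ℝ => (multiparticleDrift n Φ hΦ).1 (y + t • v))
      (fderiv ℝ (multiparticleDrift n Φ hΦ).1 y v) 0 :=
  ((multiparticleDrift n Φ hΦ).differentiableAt y).hasFDerivAt.hasLineDerivAt v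

lemma fderiv_multiparticleDrift_fst (y v : PhaseSpace n) :
    (fderiv ℝ (multiparticleDrift n Φ hΦ).1 y v).1 = v.2 := by
  have h : HasDerivAt (fun t : ℝ => y.2 + t • v.2)
      (fderiv ℝ (multiparticleDrift n Φ hΦ).1 y v).1 0 :=
    (ContinuousLinearMap.fst ℝ (Fin n → ℝ) (Fin n → ℝ)).hasFDerivAt.comp_hasDerivAt (0 : ℝ)
      (hasDerivAt_multiparticleDrift hΦ y v)
  have h' : HasDerivAt (fun t : ℝ => y.2 + t • v.2) v.2 0 := by
    simpa using ((hasDerivAt_id (0 : ℝ)).smul_const v.2).const_add y.2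
  exact h.unique h'

lemma hasDerivAt_interactionForce (y v : PhaseSpace n) (l : Fin n) :
    HasDerivAt (fun t : ℝ => interactionForce (deriv Φ) (y.1 + t • v.1) l)
      ((fderiv ℝ (multiparticleDrift n Φ hΦ).1 y v).2 l) 0 :=
  hasDerivAt_pi.1 ((ContinuousLinearMap.snd ℝ (Fin n → ℝ)
    (Fin n → ℝ)).hasFDerivAt.comp_hasDerivAt (0 : ℝ) (hasDerivAt_multiparticleDrift hΦ y v)) l

lemma fderiv_multiparticleDrift_momentum (y : PhaseSpace n) (k : Fin n) :
    fderiv ℝ (multiparticleDrift n Φ hΦ).1 y (0, Pi.single k 1) = (Pi.single k 1, 0) := by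
  refine Prod.ext (fderiv_multiparticleDrift_fst hΦ y _) (funext fun l => ?_)
  refine (hasDerivAt_interactionForce hΦ y _ l).unique ?_
  simpa using hasDerivAt_const (0 : ℝ) (interactionForce (deriv Φ) y.1 l)

/-- The force on a particle does not depend on the positions of the particles that precede its
predecessor. -/
lemma fderiv_multiparticleDrift_position_of_lt (y : PhaseSpace n) {i l : Fin n}
    (h : i.val + 1 < l.val) :
    (fderiv ℝ (multiparticleDrift n Φ hΦ).1 y (Pi.single i 1, 0)).2 l = 0 := by
  refine (hasDerivAt_interactionForce hΦ y _ l).unique ?_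
  refine (hasDerivAt_const (0 : ℝ) (interactionForce (deriv Φ) y.1 l)).congr_of_eventuallyEq
    (.of_eq (funext fun t => ?_))
  have h₀ : ∀ m : Fin n, i.val < m.val → (Pi.single i (1 : ℝ) : Fin n → ℝ) m = 0 := fun m hm =>
    Pi.single_eq_of_ne (Fin.ne_of_gt hm) _
  have h₁ := h₀ l (by omega)
  have h₂ := h₀ ⟨l.val - 1, by omega⟩ (by simp only; omega)
  unfold interactionForce
  congr 1
  · simp [h₁, h₂]
  · refine dite_congr rfl (fun hl => ?_) fun _ => rfl
    simp [h₁, h₀ ⟨l.val + 1, hl⟩ (by simp only; omega)]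

lemma fderiv_multiparticleDrift_position_succ (y : PhaseSpace n) {i j : Fin n}
    (h : j.val = i.val + 1) :
    (fderiv ℝ (multiparticleDrift n Φ hΦ).1 y (Pi.single i 1, 0)).2 j =
      deriv (deriv Φ) (y.1 i - y.1 j) := by
  refine (hasDerivAt_interactionForce hΦ y _ j).unique ?_
  have h₀ : ∀ m : Fin n, i.val < m.val → (Pi.single i (1 : ℝ) : Fin n → ℝ) m = 0 := fun m hm =>
    Pi.single_eq_of_ne (Fin.ne_of_gt hm) _
  have h₁ := h₀ j (by omega)
  have hi : (⟨j.val - 1, by omega⟩ : Fin n) = i := Fin.ext (by simp only; omega)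
  have hin : HasDerivAt (fun t : ℝ => y.1 i + t - y.1 j) 1 0 := by
    simpa using ((hasDerivAt_id (0 : ℝ)).const_add (y.1 i)).sub_const (y.1 j)
  have hout : HasDerivAt (deriv Φ) (deriv (deriv Φ) (y.1 i - y.1 j)) (y.1 i + 0 - y.1 j) := by
    rw [add_zero]
    exact (hΦ.deriv _ (Set.mem_univ _)).differentiableAt.hasDerivAt
  have hcomp := (hout.comp (0 : ℝ) hin).sub_const
    (if hj : j.val + 1 < n then deriv Φ (y.1 j - y.1 ⟨j.val + 1, hj⟩) else 0)
  rw [mul_one] at hcomp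
  refine hcomp.congr_of_eventuallyEq (.of_eq (funext fun t => ?_))
  unfold interactionForce
  congr 1
  · simp [h₁, hi, show 0 < j.val by omega]
  · refine dite_congr rfl (fun hj => ?_) fun _ => rfl
    simp [h₁, h₀ ⟨j.val + 1, hj⟩ (by simp only; omega)]

variable {ι : Type*} {g : ι → AnalyticVectorField (PhaseSpace n)} {x : PhaseSpace n}

lemma ZeroTimeGerm.position_of_momentum {k : Fin n}
    (hk : ZeroTimeGerm (multiparticleDrift n Φ hΦ) g x (fun _ => (0, Pi.single k 1))) :
    ZeroTimeGerm (multiparticleDrift n Φ hΦ) g x (fun _ => (Pi.single k 1, 0)) := by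
  refine hk.lieBracket_drift.neg.congr (.of_eq (funext fun y => ?_))
  rw [Pi.neg_apply, lieBracket_const_right, neg_neg, fderiv_multiparticleDrift_momentum]

/-- The field `φ'(q_i - q_{i+1}) ∂/∂p_{i+1}` is obtained from `-[f, ∂/∂q_i]` by removing the
components along `∂/∂p_l` with `l ≤ i`. -/
lemma ZeroTimeGerm.deriv_smul_momentum_succ {i j : Fin n} (hij : j.val = i.val + 1)
    (hq : ZeroTimeGerm (multiparticleDrift n Φ hΦ) g x (fun _ => (Pi.single i 1, 0)))
    (hp : ∀ l ≤ i, ZeroTimeGerm (multiparticleDrift n Φ hΦ) g x (fun _ => (0, Pi.single l 1))) :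
    ZeroTimeGerm (multiparticleDrift n Φ hΦ) g x
      (fun y => deriv (deriv Φ) (y.1 i - y.1 j) • (0, Pi.single j 1)) := by
  set r : PhaseSpace n → PhaseSpace n :=
    fun y => fderiv ℝ (multiparticleDrift n Φ hΦ).1 y (Pi.single i 1, 0)
  have hr : ZeroTimeGerm (multiparticleDrift n Φ hΦ) g x r := by
    refine hq.lieBracket_drift.neg.congr (.of_eq (funext fun y => ?_))
    rw [Pi.neg_apply, lieBracket_const_right, neg_neg]
  have hc : ∀ l, AnalyticAt ℝ (fun y => (r y).2 l) x := fun l =>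
    ((ContinuousLinearMap.proj (R := ℝ) (φ := fun _ : Fin n => ℝ) l).comp
      (ContinuousLinearMap.snd ℝ (Fin n → ℝ) (Fin n → ℝ))).analyticAt _ |>.comp hr.analyticAt
  refine (hr.add (ZeroTimeGerm.sum (Finset.Iic i)
    fun l hl => ZeroTimeGerm.smul (hc l) (hp l (Finset.mem_Iic.1 hl))).neg).congr
    (.of_eq (funext fun y => ?_))
  have hr₁ : (r y).1 = 0 := fderiv_multiparticleDrift_fst hΦ y _
  refine Prod.ext ?_ (funext fun m => ?_)
  · simp [hr₁, Prod.fst_sum]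
  · have hsum : (∑ l ∈ Finset.Iic i, (fun y => (r y).2 l • ((0, Pi.single l 1) : PhaseSpace n)))
        y = (0, fun m => if m ≤ i then (r y).2 m else 0) := by
      refine Prod.ext ?_ (funext fun m => ?_)
      · simp [Prod.fst_sum]
      · simp [Prod.snd_sum, Finset.sum_apply, Pi.single_apply]
    rw [Pi.add_apply, Pi.neg_apply, hsum]
    rcases lt_trichotomy m j with hm | rfl | hm
    · have hmi : m ≤ i := by rw [Fin.le_def]; rw [Fin.lt_def] at hm; omega
      simp [hmi, hm.ne]
    · have hmi : ¬ m ≤ i := by rw [Fin.le_def]; omega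
      simpa [hmi] using fderiv_multiparticleDrift_position_succ hΦ y hij
    · have hmi : ¬ m ≤ i := by rw [Fin.le_def]; rw [Fin.lt_def] at hm; omega
      simpa [hmi, hm.ne'] using fderiv_multiparticleDrift_position_of_lt hΦ y
        (i := i) (l := m) (by rw [Fin.lt_def] at hm; omega)

/-- The linear form `(q, p) ↦ q i - q j` on the phase space. -/
def positionDiff (i j : Fin n) : PhaseSpace n →L[ℝ] ℝ :=
  (ContinuousLinearMap.proj (R := ℝ) (φ := fun _ : Fin n => ℝ) i -
    ContinuousLinearMap.proj j).comp (ContinuousLinearMap.fst ℝ (Fin n → ℝ) (Fin n → ℝ))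

/-- Brackets with `∂/∂q_i` differentiate the coefficient `φ'(q_i - q_j)`. -/
lemma ZeroTimeGerm.iteratedDeriv_smul_momentum {i j : Fin n} (hij : i ≠ j)
    (hq : ZeroTimeGerm (multiparticleDrift n Φ hΦ) g x (fun _ => (Pi.single i 1, 0)))
    (h : ZeroTimeGerm (multiparticleDrift n Φ hΦ) g x
      (fun y => deriv (deriv Φ) (y.1 i - y.1 j) • (0, Pi.single j 1))) (m : ℕ) :
    ZeroTimeGerm (multiparticleDrift n Φ hΦ) g x
      (fun y => iteratedDeriv (m + 1) (deriv Φ) (y.1 i - y.1 j) • (0, Pi.single j 1)) := by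
  induction m with
  | zero => simpa [iteratedDeriv_one] using h
  | succ m ih =>
    refine (hq.lieBracket ih).congr (.of_eq (funext fun y => ?_))
    set ψ := iteratedDeriv (m + 1) (deriv Φ)
    have hψ : HasDerivAt ψ (iteratedDeriv (m + 2) (deriv Φ) (y.1 i - y.1 j))
        (y.1 i - y.1 j) := by
      rw [iteratedDeriv_succ]
      have hψa : AnalyticOnNhd ℝ ψ Set.univ := analyticOnNhd_iteratedDeriv hΦ.deriv (m + 1)
      exact (hψa _ (Set.mem_univ _)).differentiableAt.hasDerivAt
    have hcomp : HasFDerivAt (fun z : PhaseSpace n => ψ (z.1 i - z.1 j))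
        (iteratedDeriv (m + 2) (deriv Φ) (y.1 i - y.1 j) • positionDiff i j) y :=
      HasDerivAt.comp_hasFDerivAt (f := fun z : PhaseSpace n => z.1 i - z.1 j) y hψ
        (positionDiff i j).hasFDerivAt
    have hd := hcomp.smul_const ((0, Pi.single j 1) : PhaseSpace n)
    rw [lieBracket_swap, lieBracket_const_right, neg_neg, hd.fderiv]
    simp [positionDiff, Pi.single_eq_of_ne hij.symm]

lemma ZeroTimeGerm.momentum_succ (hbdd : BddBelow (Set.range Φ)) (hlim : Tendsto Φ atTop atTop)
    {i j : Fin n} (hij : j.val = i.val + 1)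
    (hp : ∀ l ≤ i, ZeroTimeGerm (multiparticleDrift n Φ hΦ) g x (fun _ => (0, Pi.single l 1))) :
    ZeroTimeGerm (multiparticleDrift n Φ hΦ) g x (fun _ => (0, Pi.single j 1)) := by
  have hq := ZeroTimeGerm.position_of_momentum hΦ (hp i le_rfl)
  obtain ⟨m, hm⟩ := exists_iteratedDeriv_deriv_ne_zero hΦ hbdd hlim (x.1 i - x.1 j)
  refine ZeroTimeGerm.of_smul ?_ hm (ZeroTimeGerm.iteratedDeriv_smul_momentum hΦ
    (fun h => by rw [h] at hij; omega) hq
    (ZeroTimeGerm.deriv_smul_momentum_succ hΦ hij hq hp) m)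
  have hψ : AnalyticOnNhd ℝ (iteratedDeriv (m + 1) (deriv Φ)) Set.univ :=
    analyticOnNhd_iteratedDeriv hΦ.deriv (m + 1)
  exact AnalyticAt.comp (f := fun y : PhaseSpace n => y.1 i - y.1 j) (hψ _ (Set.mem_univ _))
    ((positionDiff i j).analyticAt x)

lemma ZeroTimeGerm.momentum (hn : 1 ≤ n) (hbdd : BddBelow (Set.range Φ))
    (hlim : Tendsto Φ atTop atTop) (k : Fin n) :
    ZeroTimeGerm (multiparticleDrift n Φ hΦ) (fun _ : Unit => momentumField (⟨0, hn⟩ : Fin n)) x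
      (fun _ => (0, Pi.single k 1)) := by
  obtain ⟨k, hk⟩ := k
  induction k using Nat.strong_induction_on with
  | _ k ih =>
    rcases k with _ | k
    · exact ZeroTimeGerm.controlled ()
    · exact ZeroTimeGerm.momentum_succ hΦ hbdd hlim (i := ⟨k, by omega⟩) rfl
        fun l hl => ih l.val (Nat.lt_succ_of_le hl) l.isLt

end Multiparticle

end

theorem mainTheorem8 (n : ℕ) (hn : 1 ≤ n) (Φ : ℝ → ℝ)
    (hΦ : AnalyticOnNhd ℝ Φ Set.univ)
    (hbdd : BddBelow (Set.range Φ))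
    (hlim : Filter.Tendsto Φ Filter.atTop Filter.atTop)
    (x : PhaseSpace n) :
    Module.finrank ℝ
      (zeroTimeIdealAt (multiparticleDrift n Φ hΦ)
        (fun _ : Unit => momentumField (⟨0, hn⟩ : Fin n)) x) = 2 * n := by
  have hp := fun k => ZeroTimeGerm.momentum (x := x) hΦ hn hbdd hlim k
  have htop : zeroTimeIdealAt (multiparticleDrift n Φ hΦ)
      (fun _ : Unit => momentumField (⟨0, hn⟩ : Fin n)) x = ⊤ := by
    refine Submodule.eq_top_iff'.2 fun v => ?_
    have hv : v = ∑ k, (v.1 k • ((Pi.single k 1, 0) : PhaseSpace n) +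
        v.2 k • ((0, Pi.single k 1) : PhaseSpace n)) := by
      refine Prod.ext (funext fun m => ?_) (funext fun m => ?_)
      · simp [Prod.fst_sum, Finset.sum_apply, Pi.single_apply]
      · simp [Prod.snd_sum, Finset.sum_apply, Pi.single_apply]
    rw [hv]
    exact Submodule.sum_mem _ fun k _ => add_mem
      (Submodule.smul_mem _ _ (ZeroTimeGerm.position_of_momentum hΦ (hp k)).apply_mem)
      (Submodule.smul_mem _ _ (hp k).apply_mem)
  rw [htop, finrank_top, Module.finrank_prod, Module.finrank_fin_fun, two_mul]
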